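/- Let $(X,\mathcal B,\mu)$ be a probability space and $m$ a positive integer. Let $S$ assign to each $x\in X$ a finite set $S(x)\subset X$ with $1\le |S(x)|\le m$ (an $m$-transformation). Suppose that $S$ is measurable, i.e. $\{x : |S(x)|=k,\ |S(x)\cap B|=l\}\in\mathcal B$ for all $B\in\mathcal B$ and all integers $k,l\ge 0$, and that $S$ preserves $\mu$, i.e. $$\int_X \frac{1}{|S(x)|}\sum_{y\in S(x)}\chi_B(y)\,d\mu(x)=\mu(B)\qquad\text{for all } B\in\mathcal B .$$ For $f:X\to\mathbb R$ put $$Uf(x)=\frac1{|S(x)|}\sum_{y\in S(x)}f(y),\qquad A_n(f)=\frac1n\sum_{k=0}^{n-1}U^kf\quad(n\ge 1).$$ Let $1\le p<\infty$ and let $f\in\mathcal L^p(\mu)$ be real-valued. Then $A_n(f)\in\mathcal L^p(\mu)$ for every $n\ge1$, and there exists $f^*\in\mathcal L^p(\mu)$ such that $Uf^*=f^*$ $\mu$-almost everywhere and $$\|f^*-A_n(f)\|_p\to 0\quad\text{as } n\to\infty .$$ -/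

import Mathlib

open MeasureTheory Filter Topology
open scoped ENNReal

noncomputable section

namespace MultiDyn

variable {X : Type*}

/-- A multivalued map `S` with finite values is an `m`-transformation if `1 ≤ |S(x)| ≤ m` for
every `x`. -/
def IsMTransformation (m : ℕ) (S : X → Finset X) : Prop :=
  ∀ x, 1 ≤ (S x).card ∧ (S x).card ≤ m

/-- `S⁻¹_{k;l}(B) = {x : |S(x)| = k, |S(x) ∩ B| = l}`. -/
def preimageKL (S : X → Finset X) (k l : ℕ) (B : Set X) : Set X :=
  {x | (S x).card = k ∧ ((S x : Set X) ∩ B).ncard = l}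

/-- Measurability of a finite-valued multivalued map. -/
def IsMeasurableMulti [MeasurableSpace X] (S : X → Finset X) : Prop :=
  ∀ B : Set X, MeasurableSet B → ∀ k l : ℕ, MeasurableSet (preimageKL S k l B)

/-- The stochastic kernel `K(x, B) = |S(x)|⁻¹ ∑_{y ∈ S(x)} χ_B(y)`. -/
def stochKernel (S : X → Finset X) (x : X) (B : Set X) : ℝ≥0∞ :=
  ((S x).card : ℝ≥0∞)⁻¹ * ∑ y ∈ S x, B.indicator (fun _ => (1 : ℝ≥0∞)) y

/-- The set function `Sμ(B) = ∫ K(x, B) dμ(x)`. -/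
def pushMeasure [MeasurableSpace X] (S : X → Finset X) (μ : Measure X) (B : Set X) : ℝ≥0∞ :=
  ∫⁻ x, stochKernel S x B ∂μ

/-- `S` is a measure-preserving `m`-transformation of `(X, μ)`: a measurable `m`-transformation
with `Sμ = μ` on the measurable sets. -/
structure IsMeasurePreservingMTransformation [MeasurableSpace X] (m : ℕ) (S : X → Finset X)
    (μ : Measure X) : Prop where
  isMTransformation : IsMTransformation m S
  measurable : IsMeasurableMulti S
  preserves : ∀ B : Set X, MeasurableSet B → pushMeasure S μ B = μ B

/-- The operator `Uf(x) = |S(x)|⁻¹ ∑_{y ∈ S(x)} f(y)`. -/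
def koopman (S : X → Finset X) (f : X → ℝ) (x : X) : ℝ :=
  ((S x).card : ℝ)⁻¹ * ∑ y ∈ S x, f y

/-- The averages `A_n(f) = n⁻¹ ∑_{k=0}^{n-1} U^k f` (meaningful for `n ≥ 1`). -/
def average (S : X → Finset X) (n : ℕ) (f : X → ℝ) (x : X) : ℝ :=
  (n : ℝ)⁻¹ * ∑ k ∈ Finset.range n, ((koopman S)^[k] f) x

end MultiDyn

end

namespace MultiDyn

open ProbabilityTheory Function

theorem measurable_stochKernel {X : Type*} [MeasurableSpace X] {S : X → Finset X}
    (hS : IsMeasurableMulti S) {B : Set X} (hB : MeasurableSet B) :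
    Measurable fun x => stochKernel S x B := by
  classical
  have hpair : Measurable fun x => ((S x).card, ((S x : Set X) ∩ B).ncard) := by
    refine measurable_to_countable' fun q => ?_
    convert hS B hB q.1 q.2 using 1
    ext x
    simp [preimageKL, Prod.ext_iff]
  have hval : Measurable fun q : ℕ × ℕ => (q.1 : ℝ≥0∞)⁻¹ * (q.2 : ℝ≥0∞) :=
    measurable_of_countable _
  convert hval.comp hpair using 1
  ext x
  have hcard : ((S x : Set X) ∩ B).ncard = ((S x).filter (· ∈ B)).card := by
    rw [← Set.ncard_coe_finset]
    congr 1
    ext y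
    simp
  simp [stochKernel, hcard, Set.indicator_apply]

/-- The Markov kernel sending `x` to the uniform distribution on `S x`. -/
noncomputable def uniformKernel {X : Type*} [MeasurableSpace X] (S : X → Finset X)
    (hS : IsMeasurableMulti S) : Kernel X X where
  toFun x := ((S x).card : ℝ≥0∞)⁻¹ • ∑ y ∈ S x, Measure.dirac y
  measurable' := by
    refine Measure.measurable_of_measurable_coe _ fun B hB => ?_
    simpa [stochKernel, Measure.dirac_apply' _ hB, Pi.one_def] using measurable_stochKernel hS hB

section Kernel

variable {X : Type*} [MeasurableSpace X] {S : X → Finset X} (hS : IsMeasurableMulti S)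

theorem uniformKernel_def (x : X) :
    uniformKernel S hS x = ((S x).card : ℝ≥0∞)⁻¹ • ∑ y ∈ S x, Measure.dirac y := rfl

theorem uniformKernel_apply (x : X) {B : Set X} (hB : MeasurableSet B) :
    uniformKernel S hS x B = stochKernel S x B := by
  simp [uniformKernel_def, stochKernel, Measure.dirac_apply' _ hB, Pi.one_def]

theorem lintegral_uniformKernel (x : X) {φ : X → ℝ≥0∞} (hφ : Measurable φ) :
    ∫⁻ y, φ y ∂uniformKernel S hS x = ((S x).card : ℝ≥0∞)⁻¹ * ∑ y ∈ S x, φ y := by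
  simp [uniformKernel_def, lintegral_finsetSum_measure, lintegral_dirac' _ hφ]

theorem isMarkovKernel_uniformKernel (hne : ∀ x, (S x).Nonempty) :
    IsMarkovKernel (uniformKernel S hS) where
  isProbabilityMeasure x := ⟨by
    rw [uniformKernel_apply hS x MeasurableSet.univ]
    simp only [stochKernel, Set.indicator_univ, Finset.sum_const, nsmul_eq_mul, mul_one]
    exact ENNReal.inv_mul_cancel (by simpa using (hne x).ne_empty) (by simp)⟩

theorem integral_uniformKernel (x : X) {g : X → ℝ} (hg : StronglyMeasurable g) :
    ∫ y, g y ∂uniformKernel S hS x = koopman S g x := by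
  have hint : ∀ y ∈ S x, Integrable g (Measure.dirac y) := fun y _ =>
    ⟨hg.aestronglyMeasurable, by
      rw [hasFiniteIntegral_iff_enorm, lintegral_dirac' _ hg.enorm]
      simp⟩
  rw [uniformKernel_def, integral_smul_measure, integral_finsetSum_measure hint]
  simp [koopman, integral_dirac' _ _ hg]

end Kernel

variable {X : Type*}

theorem koopman_add (S : X → Finset X) (f g : X → ℝ) :
    koopman S (f + g) = koopman S f + koopman S g := by
  ext x
  simp [koopman, Finset.sum_add_distrib, mul_add]

theorem koopman_smul (S : X → Finset X) (c : ℝ) (f : X → ℝ) :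
    koopman S (c • f) = c • koopman S f := by
  ext x
  simp [koopman, ← Finset.mul_sum, mul_left_comm]

theorem abs_koopman_le {S : X → Finset X} {f : X → ℝ} {C : ℝ} (hC : 0 ≤ C)
    (hf : ∀ x, |f x| ≤ C) (x : X) : |koopman S f x| ≤ C := by
  rcases (S x).eq_empty_or_nonempty with h | h
  · simpa [koopman, h] using hC
  · have hpos : (0 : ℝ) < (S x).card := by exact_mod_cast h.card_pos
    rw [koopman, abs_mul, abs_inv, Nat.abs_cast, inv_mul_le_iff₀ hpos]
    calc |∑ y ∈ S x, f y| ≤ ∑ y ∈ S x, |f y| := Finset.abs_sum_le_sum_abs _ _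
      _ ≤ ∑ _y ∈ S x, C := Finset.sum_le_sum fun y _ => hf y
      _ = (S x).card * C := by simp

theorem abs_iterate_koopman_le {S : X → Finset X} {f : X → ℝ} {C : ℝ} (hC : 0 ≤ C)
    (hf : ∀ x, |f x| ≤ C) (k : ℕ) (x : X) : |((koopman S)^[k] f) x| ≤ C := by
  induction k generalizing x with
  | zero => exact hf x
  | succ k ih =>
    rw [iterate_succ_apply']
    exact abs_koopman_le hC ih x

theorem abs_average_le {S : X → Finset X} {f : X → ℝ} {C : ℝ} (hC : 0 ≤ C)
    (hf : ∀ x, |f x| ≤ C) (n : ℕ) (x : X) : |average S n f x| ≤ C := by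
  rcases Nat.eq_zero_or_pos n with rfl | hn
  · simpa [average] using hC
  · have hpos : (0 : ℝ) < n := by exact_mod_cast hn
    rw [average, abs_mul, abs_inv, Nat.abs_cast, inv_mul_le_iff₀ hpos]
    calc |∑ k ∈ Finset.range n, ((koopman S)^[k] f) x|
        ≤ ∑ k ∈ Finset.range n, |((koopman S)^[k] f) x| := Finset.abs_sum_le_sum_abs _ _
      _ ≤ ∑ _k ∈ Finset.range n, C :=
          Finset.sum_le_sum fun k _ => abs_iterate_koopman_le hC hf k x
      _ = n * C := by simp

theorem average_eq (S : X → Finset X) (n : ℕ) (f : X → ℝ) :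
    average S n f = (n : ℝ)⁻¹ • ∑ k ∈ Finset.range n, (koopman S)^[k] f := by
  ext x
  simp [average]

theorem enorm_koopman_rpow_le {S : X → Finset X} (f : X → ℝ) {x : X} (hx : (S x).Nonempty) {q : ℝ} (hq : 1 ≤ q) :
    ‖koopman S f x‖ₑ ^ q ≤ ((S x).card : ℝ≥0∞)⁻¹ * ∑ y ∈ S x, ‖f y‖ₑ ^ q := by
  have hc : ((S x).card : ℝ) ≠ 0 := by exact_mod_cast hx.card_pos.ne'
  have hc' : ((S x).card : ℝ≥0∞) ≠ 0 := by exact_mod_cast hx.card_pos.ne'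
  have hle : ‖koopman S f x‖ₑ ≤ ∑ y ∈ S x, ((S x).card : ℝ≥0∞)⁻¹ * ‖f y‖ₑ := by
    rw [koopman, enorm_mul, ← Finset.mul_sum, enorm_inv hc, Real.enorm_natCast]
    gcongr
    exact enorm_sum_le _ _
  calc ‖koopman S f x‖ₑ ^ q ≤ (∑ y ∈ S x, ((S x).card : ℝ≥0∞)⁻¹ * ‖f y‖ₑ) ^ q := by gcongr
    _ ≤ ∑ y ∈ S x, ((S x).card : ℝ≥0∞)⁻¹ * ‖f y‖ₑ ^ q := by
        refine ENNReal.rpow_arith_mean_le_arith_mean_rpow _ _ _ ?_ hq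
        simpa using ENNReal.mul_inv_cancel hc' (by simp)
    _ = _ := by rw [Finset.mul_sum]

section MeasurePreserving

variable [MeasurableSpace X] {μ : Measure X} {m : ℕ} {S : X → Finset X}

theorem IsMeasurePreservingMTransformation.nonempty
    (hS : IsMeasurePreservingMTransformation m S μ) (x : X) : (S x).Nonempty :=
  Finset.card_pos.1 (hS.isMTransformation x).1

theorem IsMeasurePreservingMTransformation.bind_uniformKernel
    (hS : IsMeasurePreservingMTransformation m S μ) :
    μ.bind (uniformKernel S hS.measurable) = μ := by
  ext B hB
  rw [Measure.bind_apply hB (Kernel.aemeasurable _), ← hS.preserves B hB]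
  exact lintegral_congr fun x => uniformKernel_apply _ x hB

theorem IsMeasurePreservingMTransformation.lintegral_mean
    (hS : IsMeasurePreservingMTransformation m S μ) {φ : X → ℝ≥0∞} (hφ : Measurable φ) :
    ∫⁻ x, ((S x).card : ℝ≥0∞)⁻¹ * ∑ y ∈ S x, φ y ∂μ = ∫⁻ x, φ x ∂μ := by
  conv_rhs => rw [← hS.bind_uniformKernel]
  rw [Measure.lintegral_bind (Kernel.aemeasurable _) hφ.aemeasurable]
  exact lintegral_congr fun x => (lintegral_uniformKernel _ x hφ).symm

theorem IsMeasurePreservingMTransformation.ae_forall_mem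
    (hS : IsMeasurePreservingMTransformation m S μ) {P : X → Prop} (hP : ∀ᵐ x ∂μ, P x) :
    ∀ᵐ x ∂μ, ∀ y ∈ S x, P y := by
  set N := toMeasurable μ {x | ¬ P x} with hN
  have hNm : MeasurableSet N := measurableSet_toMeasurable _ _
  have hN0 : μ N = 0 := by rw [hN, measure_toMeasurable]; exact hP
  have h0 : ∫⁻ x, stochKernel S x N ∂μ = 0 := (hS.preserves N hNm).trans hN0
  rw [lintegral_eq_zero_iff (measurable_stochKernel hS.measurable hNm)] at h0
  filter_upwards [h0] with x hx y hy
  by_contra hPy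
  have hyN : y ∈ N := subset_toMeasurable _ _ hPy
  have hsum : ∑ y ∈ S x, N.indicator (fun _ => (1 : ℝ≥0∞)) y = 0 := by
    simpa [stochKernel] using hx
  have := Finset.sum_eq_zero_iff.1 hsum y hy
  simp [hyN] at this

theorem IsMeasurePreservingMTransformation.koopman_congr
    (hS : IsMeasurePreservingMTransformation m S μ) {f g : X → ℝ} (h : f =ᵐ[μ] g) :
    koopman S f =ᵐ[μ] koopman S g := by
  filter_upwards [hS.ae_forall_mem h] with x hx
  simp only [koopman]
  rw [Finset.sum_congr rfl hx]

theorem IsMeasurePreservingMTransformation.aestronglyMeasurable_koopman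
    (hS : IsMeasurePreservingMTransformation m S μ) {f : X → ℝ} (hf : AEStronglyMeasurable f μ) :
    AEStronglyMeasurable (koopman S f) μ := by
  have := isMarkovKernel_uniformKernel hS.measurable hS.nonempty
  refine ⟨koopman S (hf.mk f), ?_, hS.koopman_congr hf.ae_eq_mk⟩
  have h := hf.stronglyMeasurable_mk.integral_kernel (κ := uniformKernel S hS.measurable)
  simpa only [integral_uniformKernel _ _ hf.stronglyMeasurable_mk] using h

theorem IsMeasurePreservingMTransformation.eLpNorm_koopman_le
    (hS : IsMeasurePreservingMTransformation m S μ) {p : ℝ≥0∞} (hp1 : 1 ≤ p) (hp : p ≠ ∞)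
    {f : X → ℝ} (hf : AEStronglyMeasurable f μ) :
    eLpNorm (koopman S f) p μ ≤ eLpNorm f p μ := by
  have hp0 : p ≠ 0 := (zero_lt_one.trans_le hp1).ne'
  have hq : 1 ≤ p.toReal := by simpa using ENNReal.toReal_mono hp hp1
  rw [eLpNorm_congr_ae (hS.koopman_congr hf.ae_eq_mk), eLpNorm_congr_ae hf.ae_eq_mk,
    eLpNorm_eq_lintegral_rpow_enorm_toReal hp0 hp, eLpNorm_eq_lintegral_rpow_enorm_toReal hp0 hp]
  gcongr ?_ ^ _
  rw [← hS.lintegral_mean (hf.stronglyMeasurable_mk.enorm.pow_const _)]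
  exact lintegral_mono fun x => enorm_koopman_rpow_le _ (hS.nonempty x) hq

theorem IsMeasurePreservingMTransformation.memLp_koopman
    (hS : IsMeasurePreservingMTransformation m S μ) {p : ℝ≥0∞} (hp1 : 1 ≤ p) (hp : p ≠ ∞)
    {f : X → ℝ} (hf : MemLp f p μ) : MemLp (koopman S f) p μ :=
  ⟨hS.aestronglyMeasurable_koopman hf.1, (hS.eLpNorm_koopman_le hp1 hp hf.1).trans_lt hf.2⟩

theorem IsMeasurePreservingMTransformation.memLp_iterate_koopman
    (hS : IsMeasurePreservingMTransformation m S μ) {p : ℝ≥0∞} (hp1 : 1 ≤ p) (hp : p ≠ ∞)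
    {f : X → ℝ} (hf : MemLp f p μ) (k : ℕ) : MemLp ((koopman S)^[k] f) p μ := by
  induction k with
  | zero => exact hf
  | succ k ih =>
    rw [iterate_succ_apply']
    exact hS.memLp_koopman hp1 hp ih

theorem IsMeasurePreservingMTransformation.memLp_average
    (hS : IsMeasurePreservingMTransformation m S μ) {p : ℝ≥0∞} (hp1 : 1 ≤ p) (hp : p ≠ ∞)
    {f : X → ℝ} (hf : MemLp f p μ) (n : ℕ) : MemLp (average S n f) p μ := by
  rw [average_eq]
  exact (memLp_finsetSum' _ fun k _ => hS.memLp_iterate_koopman hp1 hp hf k).const_smul _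

/-- The operator induced by `koopman S` on `Lp`. -/
noncomputable def IsMeasurePreservingMTransformation.koopmanLp
    (hS : IsMeasurePreservingMTransformation m S μ) {p : ℝ≥0∞} [hp1 : Fact (1 ≤ p)] (hp : p ≠ ∞) :
    Lp ℝ p μ →L[ℝ] Lp ℝ p μ :=
  LinearMap.mkContinuous
    { toFun := fun f => (hS.memLp_koopman hp1.out hp (Lp.memLp f)).toLp _
      map_add' := fun f g => by
        rw [← MemLp.toLp_add]
        refine MemLp.toLp_congr _ _ ?_
        rw [← koopman_add]
        exact hS.koopman_congr (Lp.coeFn_add f g)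
      map_smul' := fun c f => by
        rw [RingHom.id_apply, ← MemLp.toLp_const_smul]
        refine MemLp.toLp_congr _ _ ?_
        rw [← koopman_smul]
        exact hS.koopman_congr (Lp.coeFn_smul c f) }
    1 fun f => by
      rw [one_mul, LinearMap.coe_mk, AddHom.coe_mk, Lp.norm_toLp, Lp.norm_def]
      exact ENNReal.toReal_mono (Lp.eLpNorm_ne_top f)
        (hS.eLpNorm_koopman_le hp1.out hp (Lp.aestronglyMeasurable f))

section Lp

variable (hS : IsMeasurePreservingMTransformation m S μ) {p : ℝ≥0∞} [hp1 : Fact (1 ≤ p)]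
  (hp : p ≠ ∞)

theorem IsMeasurePreservingMTransformation.norm_koopmanLp_le : ‖hS.koopmanLp hp‖ ≤ 1 :=
  LinearMap.mkContinuous_norm_le _ zero_le_one _

theorem IsMeasurePreservingMTransformation.coeFn_koopmanLp (f : Lp ℝ p μ) :
    hS.koopmanLp hp f =ᵐ[μ] koopman S f :=
  MemLp.coeFn_toLp (hS.memLp_koopman hp1.out hp (Lp.memLp f))

theorem IsMeasurePreservingMTransformation.koopmanLp_toLp {f : X → ℝ} (hf : MemLp f p μ) :
    hS.koopmanLp hp (hf.toLp f) = (hS.memLp_koopman hp1.out hp hf).toLp _ :=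
  MemLp.toLp_congr (hS.memLp_koopman hp1.out hp (Lp.memLp _)) _
    (hS.koopman_congr hf.coeFn_toLp)

theorem IsMeasurePreservingMTransformation.iterate_koopmanLp_toLp {f : X → ℝ}
    (hf : MemLp f p μ) (k : ℕ) :
    (hS.koopmanLp hp)^[k] (hf.toLp f) = (hS.memLp_iterate_koopman hp1.out hp hf k).toLp _ := by
  induction k with
  | zero => rfl
  | succ k ih =>
    rw [iterate_succ_apply', ih, koopmanLp_toLp]
    simp only [iterate_succ_apply']

theorem IsMeasurePreservingMTransformation.birkhoffAverage_koopmanLp_toLp {f : X → ℝ}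
    (hf : MemLp f p μ) (n : ℕ) :
    birkhoffAverage ℝ (hS.koopmanLp hp) _root_.id n (hf.toLp f)
      = (hS.memLp_average hp1.out hp hf n).toLp _ := by
  have hsum : ∀ s : Finset ℕ, ∑ k ∈ s, (hS.memLp_iterate_koopman hp1.out hp hf k).toLp _
      = (memLp_finsetSum' s fun k _ => hS.memLp_iterate_koopman hp1.out hp hf k).toLp _ := by
    classical
    intro s
    induction s using Finset.induction_on with
    | empty => simp only [Finset.sum_empty]; exact (MemLp.toLp_zero _).symm
    | insert a s ha ih =>
      rw [Finset.sum_insert ha, ih, ← MemLp.toLp_add]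
      exact MemLp.toLp_congr _ _ (by rw [Finset.sum_insert ha])
  rw [birkhoffAverage, birkhoffSum]
  simp only [_root_.id, hS.iterate_koopmanLp_toLp hp hf]
  rw [hsum, ← MemLp.toLp_const_smul]
  exact MemLp.toLp_congr _ _ (by rw [average_eq])

end Lp

end MeasurePreserving

section Contraction

variable {E : Type*} [NormedAddCommGroup E] [NormedSpace ℝ E]

theorem isClosed_setOf_exists_tendsto_birkhoffAverage [CompleteSpace E] {T : E → E}
    (hT : LipschitzWith 1 T) :
    IsClosed {x | ∃ y, Tendsto (birkhoffAverage ℝ T _root_.id · x) atTop (𝓝 y)} := by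
  refine isClosed_of_closure_subset fun x hx => ?_
  refine cauchySeq_tendsto_of_complete (Metric.cauchySeq_iff'.2 fun ε hε => ?_)
  have hequi := uniformEquicontinuous_birkhoffAverage ℝ hT (g := _root_.id) uniformContinuous_id
  obtain ⟨δ, hδ, H⟩ := Metric.uniformEquicontinuous_iff.1 hequi (ε / 3) (by positivity)
  obtain ⟨z, ⟨y, hy⟩, hz⟩ := Metric.mem_closure_iff.1 hx δ hδ
  obtain ⟨N, hN⟩ := Metric.cauchySeq_iff'.1 hy.cauchySeq (ε / 3) (by positivity)
  refine ⟨N, fun n hn => ?_⟩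
  have h1 := H x z hz n
  have h2 := hN n hn
  have h3 := H z x (by rwa [dist_comm]) N
  have h4 := dist_triangle4 (birkhoffAverage ℝ T _root_.id n x)
    (birkhoffAverage ℝ T _root_.id n z) (birkhoffAverage ℝ T _root_.id N z)
    (birkhoffAverage ℝ T _root_.id N x)
  linarith

theorem eq_of_tendsto_birkhoffAverage {T : E →L[ℝ] E} (hT : ‖T‖ ≤ 1) {x y : E}
    (h : Tendsto (birkhoffAverage ℝ T _root_.id · x) atTop (𝓝 y)) : T y = y := by
  have hbdd : Bornology.IsBounded (Set.range (_root_.id <| T^[·] x)) := by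
    refine isBounded_iff_forall_norm_le.2 ⟨‖x‖, Set.forall_mem_range.2 fun n => ?_⟩
    induction n with
    | zero => exact le_rfl
    | succ n ih =>
      simp only [_root_.id, iterate_succ_apply'] at ih ⊢
      exact (T.le_of_opNorm_le hT _).trans (by simpa using ih)
  have hsub := tendsto_birkhoffAverage_apply_sub_birkhoffAverage ℝ hbdd
  have hcomm : ∀ n, birkhoffAverage ℝ T _root_.id n (T x)
      = T (birkhoffAverage ℝ T _root_.id n x) := fun n => by
    simp only [birkhoffAverage, birkhoffSum, map_smul, map_sum, _root_.id,
      ← iterate_succ_apply', ← iterate_succ_apply]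
  simp only [hcomm] at hsub
  have hlim := ((T.continuous.tendsto y).comp h).sub h
  exact sub_eq_zero.1 (tendsto_nhds_unique hlim hsub)

end Contraction

section Convergence

variable [MeasurableSpace X] {μ : Measure X}

theorem unifIntegrable_of_bound {ι : Type*} {F : ι → X → ℝ} {p : ℝ≥0∞} (hp1 : 1 ≤ p)
    (hp : p ≠ ∞) (hF : ∀ i, AEStronglyMeasurable (F i) μ) {C : ℝ} (hC : ∀ i x, |F i x| ≤ C) :
    UnifIntegrable F p μ := by
  refine unifIntegrable_of hp1 hp hF fun ε _ => ⟨(C + 1).toNNReal, fun i => ?_⟩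
  have hempty : {x | (C + 1).toNNReal ≤ ‖F i x‖₊} = ∅ := by
    ext x
    have h := hC i x
    have h0 := (abs_nonneg _).trans h
    simp only [Set.mem_ofPred_eq, Set.mem_empty_iff_false, iff_false, not_le]
    rw [← NNReal.coe_lt_coe, Real.coe_toNNReal _ (by linarith), coe_nnnorm, Real.norm_eq_abs]
    linarith
  simp [hempty]

theorem TendstoInMeasure.tendsto_eLpNorm_of_bound [IsFiniteMeasure μ] {F : ℕ → X → ℝ}
    {g : X → ℝ} {p : ℝ≥0∞} (hp1 : 1 ≤ p) (hp : p ≠ ∞) (hF : ∀ i, AEStronglyMeasurable (F i) μ)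
    {C : ℝ} (hC : ∀ i x, |F i x| ≤ C) (hg : AEStronglyMeasurable g μ)
    (h : TendstoInMeasure μ F atTop g) :
    MemLp g p μ ∧ Tendsto (fun n => eLpNorm (F n - g) p μ) atTop (𝓝 0) := by
  obtain ⟨ns, -, hns⟩ := h.exists_seq_tendsto_ae
  have hbound : ∀ᵐ x ∂μ, ‖g x‖ ≤ C := by
    filter_upwards [hns] with x hx
    exact le_of_tendsto' hx.norm fun i => hC (ns i) x
  have hmem : MemLp g p μ := MemLp.of_bound hg C hbound
  exact ⟨hmem, tendsto_Lp_finite_of_tendstoInMeasure hp1 hp hF hmem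
    (unifIntegrable_of_bound hp1 hp hF hC) h⟩

variable [IsProbabilityMeasure μ] {m : ℕ} {S : X → Finset X}

theorem IsMeasurePreservingMTransformation.exists_tendsto_birkhoffAverage_of_bound
    (hS : IsMeasurePreservingMTransformation m S μ) {p : ℝ≥0∞} [hp1 : Fact (1 ≤ p)] (hp : p ≠ ∞)
    {f : X → ℝ} (hf : MemLp f p μ) {C : ℝ} (hC : ∀ x, |f x| ≤ C) :
    ∃ g, Tendsto (birkhoffAverage ℝ (hS.koopmanLp hp) _root_.id · (hf.toLp f)) atTop (𝓝 g) := by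
  have hC0 : 0 ≤ C := by
    obtain ⟨x⟩ := nonempty_of_isProbabilityMeasure μ
    exact (abs_nonneg _).trans (hC x)
  have hf2 : MemLp f 2 μ := MemLp.of_bound hf.1 C (Eventually.of_forall hC)
  have hL2 := (hS.koopmanLp (p := 2) (by simp)).tendsto_birkhoffAverage_orthogonalProjection
    (hS.norm_koopmanLp_le _) (hf2.toLp f)
  simp only [hS.birkhoffAverage_koopmanLp_toLp] at hL2 ⊢
  have hmeas := tendstoInMeasure_of_tendsto_Lp hL2
  have hmeas' := hmeas.congr_left fun n => MemLp.coeFn_toLp _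
  obtain ⟨hg, hlim⟩ := TendstoInMeasure.tendsto_eLpNorm_of_bound hp1.out hp
    (fun n => (hS.memLp_average hp1.out hp hf n).1) (abs_average_le hC0 hC)
    (Lp.aestronglyMeasurable _) hmeas'
  exact ⟨hg.toLp _, (Lp.tendsto_Lp_iff_tendsto_eLpNorm'' _ _ _ _).2 hlim⟩

theorem IsMeasurePreservingMTransformation.exists_tendsto_birkhoffAverage
    (hS : IsMeasurePreservingMTransformation m S μ) {p : ℝ≥0∞} [hp1 : Fact (1 ≤ p)] (hp : p ≠ ∞)
    (f : Lp ℝ p μ) :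
    ∃ g, Tendsto (birkhoffAverage ℝ (hS.koopmanLp hp) _root_.id · f) atTop (𝓝 g) := by
  have hlip : LipschitzWith 1 (hS.koopmanLp hp) :=
    (hS.koopmanLp hp).lipschitz.weaken (hS.norm_koopmanLp_le hp)
  refine (Lp.simpleFunc.denseRange hp).induction_on f
    (isClosed_setOf_exists_tendsto_birkhoffAverage hlip) fun s => ?_
  obtain ⟨C, hC⟩ := (Lp.simpleFunc.toSimpleFunc s).exists_forall_norm_le
  have h := hS.exists_tendsto_birkhoffAverage_of_bound hp (Lp.simpleFunc.memLp s) hC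
  rwa [← Lp.simpleFunc.toLp_eq_toLp, Lp.simpleFunc.toLp_toSimpleFunc] at h

end Convergence

end MultiDyn

theorem mainTheorem7 {X : Type*} [MeasurableSpace X] (μ : Measure X) [IsProbabilityMeasure μ]
    (m : ℕ) (S : X → Finset X) (hS : MultiDyn.IsMeasurePreservingMTransformation m S μ)
    (p : ℝ≥0∞) (hp1 : 1 ≤ p) (hp : p ≠ ∞) (f : X → ℝ) (hf : MemLp f p μ) :
    (∀ n : ℕ, 1 ≤ n → MemLp (MultiDyn.average S n f) p μ) ∧
    ∃ fstar : X → ℝ, MemLp fstar p μ ∧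
      MultiDyn.koopman S fstar =ᵐ[μ] fstar ∧
      Tendsto (fun n : ℕ => eLpNorm (fstar - MultiDyn.average S n f) p μ) atTop (𝓝 0) := by
  have : Fact (1 ≤ p) := ⟨hp1⟩
  refine ⟨fun n _ => hS.memLp_average hp1 hp hf n, ?_⟩
  obtain ⟨g, hg⟩ := hS.exists_tendsto_birkhoffAverage hp (hf.toLp f)
  refine ⟨g, Lp.memLp g, ?_, ?_⟩
  · have hfix := MultiDyn.eq_of_tendsto_birkhoffAverage (hS.norm_koopmanLp_le hp) hg
    have hae := hS.coeFn_koopmanLp hp g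
    rw [hfix] at hae
    exact hae.symm
  · simp only [hS.birkhoffAverage_koopmanLp_toLp] at hg
    rw [← Lp.toLp_coeFn g (Lp.memLp g), Lp.tendsto_Lp_iff_tendsto_eLpNorm''] at hg
    simpa only [eLpNorm_sub_comm] using hg
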